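/- Let $M=(|M|,\mathcal O_M)$ be a (real, smooth) supermanifold of dimension $n|m$: a Hausdorff second countable space with a sheaf of super $\mathbb R$-algebras, locally isomorphic to $(\mathbb R^n, C^\infty\otimes\Lambda_{\mathbb R}[\xi_1,\dots,\xi_m])$. Let $\mathcal T_M=\mathrm{Der}(\mathcal O_M)$ be its tangent sheaf, with bracket $[X,Y]=XY-(-1)^{|X||Y|}YX$, and let $\langle\cdot,\cdot\rangle$ be a graded Riemannian metric on $M$, i.e. an even, graded-symmetric, non-degenerate $\mathcal O_M$-linear morphism of sheaves $\mathcal T_M\otimes\mathcal T_M\to\mathcal O_M$ (non-degenerate: it induces an isomorphism of $\mathcal T_M$ with its dual). Let $\nabla$ be the Levi-Civita connection, i.e. the connection on $\mathcal T_M$ with $\nabla_XY-(-1)^{|X||Y|}\nabla_YX=[X,Y]$ and $X\langle Y,Z\rangle=\langle\nabla_XY,Z\rangle+(-1)^{|X||Y|}\langle Y,\nabla_XZ\rangle$, and put $$R(X,Y)Z=\nabla_X\nabla_YZ-(-1)^{|X||Y|}\nabla_Y\nabla_XZ-\nabla_{[X,Y]}Z,\qquad \nabla^2_{Y,Z}X=\nabla_Y\nabla_ZX-\nabla_{\nabla_YZ}X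 .$$ (Here and below, $|\cdot|\in\mathbb Z/2$ is the parity; formulas containing parities are for homogeneous arguments and are extended additively.) Let $X$ be a graded Killing vector field on $M$, i.e. a vector field with $X\langle Y,Z\rangle=\langle[X,Y],Z\rangle+(-1)^{|X||Y|}\langle Y,[X,Z]\rangle$ for all vector fields $Y,Z$ on open subsets of $M$; if $X=X_0+X_1$ is not homogeneous, this is required of both components $X_0$ and $X_1$. Then, for all homogeneous vector fields $Y,Z$ on an open subset of $M$, $$\nabla^2_{Y,Z}X=-(-1)^{|X|(|Y|+|Z|)}R(X,Y)Z$$ if $X$ is homogeneous; in general this holds for each of the components $X_0$, $X_1$ in place of $X$. -/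

import Mathlib

open scoped Manifold ContDiff TensorProduct
open TopologicalSpace Opposite CategoryTheory

universe u

noncomputable section

namespace Super

/-- The Koszul sign `(-1)^i` of a parity `i`. -/
def sgn (i : ZMod 2) : ℝ := (-1) ^ i.val

theorem sgn_zero : sgn 0 = 1 := by
  rw [sgn, ZMod.val_zero, pow_zero]

theorem sgn_one : sgn 1 = -1 := by
  rw [sgn, ZMod.val_one, pow_one]

theorem parity_cases (i : ZMod 2) : i = 0 ∨ i = 1 := by
  revert i
  decide

theorem sgn_mul_self (i : ZMod 2) : sgn i * sgn i = 1 := by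
  rcases parity_cases i with rfl | rfl <;> norm_num [sgn_zero, sgn_one]

theorem sgn_add (i j : ZMod 2) : sgn (i + j) = sgn i * sgn j := by
  have h : (1 + 1 : ZMod 2) = 0 := by decide
  rcases parity_cases i with rfl | rfl <;> rcases parity_cases j with rfl | rfl <;>
    simp only [h, zero_add, add_zero, sgn_zero, sgn_one] <;> norm_num

section Algebra

/-! ### Super algebras and their derivations -/

set_option linter.unusedSectionVars false

variable {A : Type u} [Ring A] [Algebra ℝ A] (𝒜 : ZMod 2 → Submodule ℝ A) [GradedAlgebra 𝒜]

/-- The component of parity `a` of an endomorphism `φ` of a super algebra: the part of `φ` which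
maps `A_j` to `A_{a+j}`. -/
def endPart (a : ZMod 2) (φ : Module.End ℝ A) : Module.End ℝ A :=
  ∑ j : ZMod 2, GradedAlgebra.proj 𝒜 (a + j) ∘ₗ φ ∘ₗ GradedAlgebra.proj 𝒜 j

/-- The homogeneous derivations of parity `a`: endomorphisms `φ` of parity `a` such that
`φ(fg) = φ(f) g + (-1)^{a|f|} f φ(g)`. -/
def homDer (a : ZMod 2) : Submodule ℝ (Module.End ℝ A) where
  carrier := {φ | (∀ j, ∀ f ∈ 𝒜 j, φ f ∈ 𝒜 (a + j)) ∧
    ∀ j, ∀ f ∈ 𝒜 j, ∀ g, φ (f * g) = φ f * g + sgn (a * j) • (f * φ g)}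
  add_mem' := by
    rintro φ ψ ⟨h1, h2⟩ ⟨h3, h4⟩
    refine ⟨fun j f hf => add_mem (h1 j f hf) (h3 j f hf), fun j f hf g => ?_⟩
    simp only [LinearMap.add_apply, h2 j f hf g, h4 j f hf g, add_mul, mul_add, smul_add]
    abel
  zero_mem' := by
    refine ⟨fun j f hf => ?_, fun j f hf g => ?_⟩ <;> simp
  smul_mem' := by
    rintro c φ ⟨h1, h2⟩
    refine ⟨fun j f hf => Submodule.smul_mem _ _ (h1 j f hf), fun j f hf g => ?_⟩
    simp only [LinearMap.smul_apply, h2 j f hf g, smul_add, smul_mul_assoc, mul_smul_comm]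
    rw [smul_comm c]

theorem endPart_add (a : ZMod 2) (φ ψ : Module.End ℝ A) :
    endPart 𝒜 a (φ + ψ) = endPart 𝒜 a φ + endPart 𝒜 a ψ := by
  ext f
  simp [endPart, Finset.sum_add_distrib]

theorem endPart_smul (a : ZMod 2) (c : ℝ) (φ : Module.End ℝ A) :
    endPart 𝒜 a (c • φ) = c • endPart 𝒜 a φ := by
  ext f
  simp [endPart, Finset.smul_sum]

theorem endPart_zero (a : ZMod 2) : endPart 𝒜 a (0 : Module.End ℝ A) = 0 := by
  ext f
  simp [endPart]

/-- The derivations of a super algebra: the endomorphisms whose homogeneous components are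
homogeneous derivations. -/
def der : Submodule ℝ (Module.End ℝ A) where
  carrier := {φ | ∀ a, endPart 𝒜 a φ ∈ homDer 𝒜 a}
  add_mem' := by
    intro φ ψ h1 h2 a
    rw [endPart_add]
    exact add_mem (h1 a) (h2 a)
  zero_mem' := by
    intro a
    rw [endPart_zero]
    exact zero_mem _
  smul_mem' := by
    intro c φ h a
    rw [endPart_smul]
    exact Submodule.smul_mem _ _ (h a)

theorem sum_proj (f : A) : ∑ j : ZMod 2, GradedAlgebra.proj 𝒜 j f = f := by
  classical
  have h := DirectSum.sum_support_decompose 𝒜 f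
  conv_rhs => rw [← h]
  symm
  apply Finset.sum_subset (Finset.subset_univ _)
  intro x _ hx
  simpa using hx

theorem proj_of_mem {i : ZMod 2} {f : A} (hf : f ∈ 𝒜 i) (j : ZMod 2) :
    GradedAlgebra.proj 𝒜 j f = if j = i then f else 0 := by
  rw [GradedAlgebra.proj_apply]
  split_ifs with h
  · subst h
    exact DirectSum.decompose_of_mem_same 𝒜 hf
  · exact DirectSum.decompose_of_mem_ne 𝒜 hf (Ne.symm h)

theorem proj_mem (i : ZMod 2) (f : A) : GradedAlgebra.proj 𝒜 i f ∈ 𝒜 i := by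
  rw [GradedAlgebra.proj_apply]
  exact SetLike.coe_mem _

theorem endPart_of_mem {a : ZMod 2} {φ : Module.End ℝ A}
    (h : ∀ j, ∀ f ∈ 𝒜 j, φ f ∈ 𝒜 (a + j)) (b : ZMod 2) :
    endPart 𝒜 b φ = if b = a then φ else 0 := by
  ext f
  have key : ∀ j, GradedAlgebra.proj 𝒜 (b + j) (φ (GradedAlgebra.proj 𝒜 j f)) =
      if b = a then φ (GradedAlgebra.proj 𝒜 j f) else 0 := by
    intro j
    rw [proj_of_mem 𝒜 (h j _ (proj_mem 𝒜 j f))]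
    simp
  simp only [endPart, LinearMap.sum_apply, LinearMap.comp_apply, key]
  split_ifs with hb
  · rw [← map_sum, sum_proj]
  · simp

theorem homDer_le_der (a : ZMod 2) : homDer 𝒜 a ≤ der 𝒜 := by
  intro φ hφ b
  rw [endPart_of_mem 𝒜 hφ.1]
  split_ifs with h
  · rw [h]
    exact hφ
  · exact zero_mem _

theorem sum_endPart (φ : Module.End ℝ A) : ∑ a : ZMod 2, endPart 𝒜 a φ = φ := by
  ext f
  simp only [endPart, LinearMap.sum_apply, LinearMap.comp_apply]
  rw [Finset.sum_comm]
  have : ∀ j : ZMod 2, ∑ a : ZMod 2,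
      GradedAlgebra.proj 𝒜 (a + j) (φ (GradedAlgebra.proj 𝒜 j f)) =
      φ (GradedAlgebra.proj 𝒜 j f) := by
    intro j
    rw [Fintype.sum_equiv (Equiv.addRight j)
      (fun a => GradedAlgebra.proj 𝒜 (a + j) (φ (GradedAlgebra.proj 𝒜 j f)))
      (fun a => GradedAlgebra.proj 𝒜 a (φ (GradedAlgebra.proj 𝒜 j f))) (fun _ => rfl)]
    exact sum_proj 𝒜 _
  simp only [this]
  rw [← map_sum, sum_proj]

/-- The super commutator: `[φ, ψ] = φψ - (-1)^{|φ||ψ|} ψφ` for homogeneous `φ`, `ψ`, extended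
bilinearly. -/
def superBracket (φ ψ : Module.End ℝ A) : Module.End ℝ A :=
  ∑ a : ZMod 2, ∑ b : ZMod 2, (endPart 𝒜 a φ * endPart 𝒜 b ψ -
    sgn (a * b) • (endPart 𝒜 b ψ * endPart 𝒜 a φ))

theorem commutator_mem {a b : ZMod 2} {φ ψ : Module.End ℝ A} (hφ : φ ∈ homDer 𝒜 a)
    (hψ : ψ ∈ homDer 𝒜 b) : φ * ψ - sgn (a * b) • (ψ * φ) ∈ homDer 𝒜 (a + b) := by
  refine ⟨fun j f hf => ?_, fun j f hf g => ?_⟩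
  · refine sub_mem ?_ (Submodule.smul_mem _ _ ?_)
    · have := hφ.1 _ _ (hψ.1 j f hf)
      rwa [← add_assoc] at this
    · have := hψ.1 _ _ (hφ.1 j f hf)
      rwa [← add_assoc, add_comm b a] at this
  · simp only [LinearMap.sub_apply, LinearMap.smul_apply, Module.End.mul_apply,
      hψ.2 j f hf g, hφ.2 j f hf g, map_add, map_smul, hφ.2 j f hf, hψ.2 j f hf,
      hφ.2 _ _ (hψ.1 j f hf), hψ.2 _ _ (hφ.1 j f hf), mul_add, add_mul, sgn_add, sub_mul,
      mul_sub, smul_add, smul_sub, smul_smul, smul_mul_assoc, mul_smul_comm, mul_comm b a]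
    have h1 := sgn_mul_self (a * b)
    match_scalars <;> first | ring1 | linear_combination (sgn (b * j)) * h1 | linear_combination (-sgn (b * j)) * h1

theorem superBracket_mem {φ ψ : Module.End ℝ A} (hφ : φ ∈ der 𝒜) (hψ : ψ ∈ der 𝒜) :
    superBracket 𝒜 φ ψ ∈ der 𝒜 :=
  Submodule.sum_mem _ fun a _ => Submodule.sum_mem _ fun b _ =>
    homDer_le_der 𝒜 (a + b) (commutator_mem 𝒜 (hφ a) (hψ b))

theorem mul_mem_homDer (hcomm : ∀ i j, ∀ f ∈ 𝒜 i, ∀ g ∈ 𝒜 j, f * g = sgn (i * j) • (g * f))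
    {a b : ZMod 2} {f : A} (hf : f ∈ 𝒜 a) {φ : Module.End ℝ A} (hφ : φ ∈ homDer 𝒜 b) :
    LinearMap.mulLeft ℝ f * φ ∈ homDer 𝒜 (a + b) := by
  refine ⟨fun j g hg => ?_, fun j g hg h => ?_⟩
  · have := SetLike.mul_mem_graded hf (hφ.1 j g hg)
    rwa [← add_assoc] at this
  · simp only [Module.End.mul_apply, LinearMap.mulLeft_apply, hφ.2 j g hg h, mul_add,
      mul_smul_comm, add_mul, sgn_add, ← mul_assoc, hcomm a j f hf g hg, smul_mul_assoc,
      smul_smul]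
    rw [mul_comm]

theorem mul_mem_der (hcomm : ∀ i j, ∀ f ∈ 𝒜 i, ∀ g ∈ 𝒜 j, f * g = sgn (i * j) • (g * f))
    (f : A) {φ : Module.End ℝ A} (hφ : φ ∈ der 𝒜) : LinearMap.mulLeft ℝ f * φ ∈ der 𝒜 := by
  have h : LinearMap.mulLeft ℝ f * φ = ∑ a : ZMod 2, ∑ b : ZMod 2,
      LinearMap.mulLeft ℝ (GradedAlgebra.proj 𝒜 a f) * endPart 𝒜 b φ := by
    simp only [← Finset.mul_sum, sum_endPart, ← Finset.sum_mul]
    congr 1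
    conv_lhs => rw [← sum_proj 𝒜 f]
    ext g
    simp [Finset.sum_mul]
  rw [h]
  exact Submodule.sum_mem _ fun a _ => Submodule.sum_mem _ fun b _ =>
    homDer_le_der 𝒜 (a + b) (mul_mem_homDer 𝒜 hcomm (proj_mem 𝒜 a f) (hφ b))

end Algebra

section Model

/-! ### The local model -/

/-- `ℝⁿ`. -/
abbrev Euc (n : ℕ) := EuclideanSpace ℝ (Fin n)

/-- Sections over an open `W ⊆ ℝⁿ` of the structure sheaf of `ℝ^{n|m}`, the super algebra
`C^∞(W) ⊗ Λ_ℝ[ξ₁, …, ξ_m]`. -/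
abbrev Model (n m : ℕ) (W : Opens (Euc n)) : Type :=
  C^∞⟮𝓘(ℝ, Euc n), W; 𝓘(ℝ, ℝ), ℝ⟯ ⊗[ℝ] ExteriorAlgebra ℝ (Fin m → ℝ)

/-- Restriction of smooth functions. -/
def smoothRes {n : ℕ} {W' W : Opens (Euc n)} (h : W' ≤ W) :
    C^∞⟮𝓘(ℝ, Euc n), W; 𝓘(ℝ, ℝ), ℝ⟯ →ₐ[ℝ] C^∞⟮𝓘(ℝ, Euc n), W'; 𝓘(ℝ, ℝ), ℝ⟯ :=
  { ContMDiffMap.restrictRingHom 𝓘(ℝ, Euc n) 𝓘(ℝ, ℝ) ℝ h with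
    commutes' := fun _ => rfl }

/-- The restriction maps of the structure sheaf of `ℝ^{n|m}`. -/
def modelRes {n : ℕ} (m : ℕ) {W' W : Opens (Euc n)} (h : W' ≤ W) :
    Model n m W →ₐ[ℝ] Model n m W' :=
  Algebra.TensorProduct.map (smoothRes h) (AlgHom.id ℝ _)

/-- The even and the odd part of `C^∞(W) ⊗ Λ_ℝ[ξ₁, …, ξ_m]`: smooth functions are even, the
`ξ_α` are odd. -/
def modelParity (n m : ℕ) (W : Opens (Euc n)) (i : ZMod 2) : Submodule ℝ (Model n m W) :=
  Submodule.span ℝ {t | ∃ f, ∃ w ∈ CliffordAlgebra.evenOdd (0 : QuadraticForm ℝ (Fin m → ℝ)) i,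
    t = f ⊗ₜ[ℝ] w}

theorem exterior_ι_comm {m : ℕ} (v : Fin m → ℝ) (j : ZMod 2)
    (y : ExteriorAlgebra ℝ (Fin m → ℝ))
    (hy : y ∈ CliffordAlgebra.evenOdd (0 : QuadraticForm ℝ (Fin m → ℝ)) j) :
    ExteriorAlgebra.ι ℝ v * y = sgn j • (y * ExteriorAlgebra.ι ℝ v) := by
  have anti : ∀ v w : Fin m → ℝ, ExteriorAlgebra.ι ℝ v * ExteriorAlgebra.ι ℝ w =
      -(ExteriorAlgebra.ι ℝ w * ExteriorAlgebra.ι ℝ v) := fun v w =>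
    eq_neg_of_add_eq_zero_left (ExteriorAlgebra.ι_add_mul_swap v w)
  induction y, hy using CliffordAlgebra.evenOdd_induction with
  | range_ι_pow w hw =>
    fin_cases j
    · change w ∈ _ ^ 0 at hw
      rw [pow_zero] at hw
      obtain ⟨r, rfl⟩ := Submodule.mem_one.mp hw
      change _ = sgn 0 • _
      rw [sgn_zero, one_smul]
      exact (Algebra.commutes r (ExteriorAlgebra.ι ℝ v)).symm
    · change w ∈ _ ^ 1 at hw
      rw [pow_one] at hw
      obtain ⟨r, rfl⟩ := hw
      have h2 := anti v r
      change _ = sgn 1 • _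
      rw [sgn_one, neg_one_smul]
      exact h2
  | add x y _ _ hx hy => rw [mul_add, add_mul, hx, hy, smul_add]
  | ι_mul_ι_mul a b x _ hx =>
    change ExteriorAlgebra.ι ℝ v * (ExteriorAlgebra.ι ℝ a * ExteriorAlgebra.ι ℝ b * x) =
      sgn j • (ExteriorAlgebra.ι ℝ a * ExteriorAlgebra.ι ℝ b * x * ExteriorAlgebra.ι ℝ v)
    rw [← mul_assoc, ← mul_assoc, anti v a, neg_mul, mul_assoc (ExteriorAlgebra.ι ℝ a), anti v b,
      mul_neg, neg_neg, ← mul_assoc, mul_assoc, hx, mul_smul_comm, mul_assoc, mul_assoc, mul_assoc]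

theorem exterior_comm {m : ℕ} (i j : ZMod 2) (x y : ExteriorAlgebra ℝ (Fin m → ℝ))
    (hx : x ∈ CliffordAlgebra.evenOdd (0 : QuadraticForm ℝ (Fin m → ℝ)) i)
    (hy : y ∈ CliffordAlgebra.evenOdd (0 : QuadraticForm ℝ (Fin m → ℝ)) j) :
    x * y = sgn (i * j) • (y * x) := by
  induction x, hx using CliffordAlgebra.evenOdd_induction with
  | range_ι_pow w hw =>
    fin_cases i
    · change w ∈ _ ^ 0 at hw
      rw [pow_zero] at hw
      obtain ⟨r, rfl⟩ := Submodule.mem_one.mp hw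
      change _ = sgn (0 * j) • _
      rw [Algebra.commutes, zero_mul, sgn_zero, one_smul]
    · change w ∈ _ ^ 1 at hw
      rw [pow_one] at hw
      obtain ⟨r, rfl⟩ := hw
      change _ = sgn (1 * j) • _
      rw [one_mul]
      exact exterior_ι_comm r j y hy
  | add x x' _ _ hx hx' => rw [mul_add, add_mul, hx, hx', smul_add]
  | ι_mul_ι_mul a b x _ hx =>
    change ExteriorAlgebra.ι ℝ a * ExteriorAlgebra.ι ℝ b * x * y =
      sgn (i * j) • (y * (ExteriorAlgebra.ι ℝ a * ExteriorAlgebra.ι ℝ b * x))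
    have ha := exterior_ι_comm a j y hy
    have hb := exterior_ι_comm b j y hy
    have hs : sgn j * sgn j = 1 := sgn_mul_self j
    rw [mul_assoc _ x y, hx, mul_smul_comm]
    congr 1
    rw [← mul_assoc, mul_assoc _ _ y, hb, mul_smul_comm, ← mul_assoc, ha, smul_mul_assoc,
      smul_mul_assoc, smul_mul_assoc, smul_smul, hs, one_smul]
    simp only [mul_assoc]

theorem model_comm (n m : ℕ) (W : Opens (Euc n)) (i j : ZMod 2) (f g : Model n m W)
    (hf : f ∈ modelParity n m W i) (hg : g ∈ modelParity n m W j) :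
    f * g = sgn (i * j) • (g * f) := by
  induction hf, hg using Submodule.span_induction₂ with
  | mem_mem x y hx hy =>
    obtain ⟨f, w, hw, rfl⟩ := hx
    obtain ⟨g, w', hw', rfl⟩ := hy
    rw [Algebra.TensorProduct.tmul_mul_tmul, Algebra.TensorProduct.tmul_mul_tmul,
      exterior_comm i j w w' hw hw', mul_comm, TensorProduct.tmul_smul]
  | zero_left y _ => simp
  | zero_right x _ => simp
  | add_left x y z _ _ _ h1 h2 => rw [add_mul, mul_add, h1, h2, smul_add]
  | add_right x y z _ _ _ h1 h2 => rw [add_mul, mul_add, h1, h2, smul_add]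
  | smul_left r x y _ _ h => rw [smul_mul_assoc, h, mul_smul_comm, smul_comm]
  | smul_right r x y _ _ h => rw [smul_mul_assoc, mul_smul_comm, h, smul_comm]

end Model

/-! ### Supermanifolds -/

/-- The open subsets of `U`. -/
abbrev Below {T : Type u} [TopologicalSpace T] (U : Opens T) : Type u := {V : Opens T // V ≤ U}

/-- A topological space with a sheaf of super `ℝ`-algebras with unity. -/
structure SuperRingedSpace where
  carrier : TopCat.{u}
  sheaf : TopCat.Sheaf (AlgCat.{u} ℝ) carrier
  /-- The even and the odd sections. -/
  parity : ∀ U : Opens carrier, ZMod 2 → Submodule ℝ (sheaf.presheaf.obj (op U))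
  graded : ∀ U : Opens carrier, GradedAlgebra (parity U)
  map_parity : ∀ (U V : Opens carrier) (h : V ≤ U) (i : ZMod 2), ∀ f ∈ parity U i,
    (sheaf.presheaf.map (homOfLE h).op).hom f ∈ parity V i

namespace SuperRingedSpace

variable (M : SuperRingedSpace.{u})

/-- The superfunctions on `U`. -/
abbrev O (U : Opens M.carrier) : Type u := M.sheaf.presheaf.obj (op U)

instance (U : Opens M.carrier) : GradedAlgebra (M.parity U) := M.graded U

/-- Restriction of superfunctions. -/
def res {U V : Opens M.carrier} (h : V ≤ U) : M.O U →ₐ[ℝ] M.O V :=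
  (M.sheaf.presheaf.map (homOfLE h).op).hom

theorem res_res {U V W : Opens M.carrier} (h : V ≤ U) (h' : W ≤ V) (f : M.O U) :
    M.res h' (M.res h f) = M.res (h'.trans h) f := by
  have : M.sheaf.presheaf.map (homOfLE (h'.trans h)).op =
      M.sheaf.presheaf.map (homOfLE h).op ≫ M.sheaf.presheaf.map (homOfLE h').op := by
    rw [← Functor.map_comp]
    rfl
  simp only [res, this]
  rfl

theorem res_mem {U V : Opens M.carrier} (h : V ≤ U) {i : ZMod 2} {f : M.O U}
    (hf : f ∈ M.parity U i) : M.res h f ∈ M.parity V i :=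
  M.map_parity U V h i f hf

theorem res_proj {U V : Opens M.carrier} (h : V ≤ U) (i : ZMod 2) (f : M.O U) :
    M.res h (GradedAlgebra.proj (M.parity U) i f) =
      GradedAlgebra.proj (M.parity V) i (M.res h f) := by
  conv_rhs => rw [← sum_proj (M.parity U) f, map_sum, map_sum]
  simp only [proj_of_mem (M.parity V) (M.res_mem h (proj_mem (M.parity U) _ f))]
  simp

/-- The open set of all points of the domain of `φ` which are mapped to `W`. -/
def preimage {n : ℕ} (φ : OpenPartialHomeomorph M.carrier (Euc n)) (W : Opens (Euc n)) :
    Opens M.carrier :=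
  ⟨φ.source ∩ φ ⁻¹' W, φ.isOpen_inter_preimage W.isOpen⟩

theorem preimage_mono {n : ℕ} (φ : OpenPartialHomeomorph M.carrier (Euc n))
    {W' W : Opens (Euc n)} (h : W' ≤ W) : M.preimage φ W' ≤ M.preimage φ W :=
  fun _ hx => ⟨hx.1, h hx.2⟩

/-- An isomorphism of an open subspace of `M` with an open subspace of `ℝ^{n|m}`: a homeomorphism
`φ` between the open sets, together with isomorphisms of super algebras
`𝒪_M(φ⁻¹(W)) ≅ C^∞(W) ⊗ Λ_ℝ[ξ₁, …, ξ_m]`, for all open subsets `W` of the target of `φ`, which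
are compatible with restrictions. -/
structure Chart (n m : ℕ) where
  φ : OpenPartialHomeomorph M.carrier (Euc n)
  iso : ∀ W : Opens (Euc n), (W : Set (Euc n)) ⊆ φ.target → (M.O (M.preimage φ W) ≃ₐ[ℝ] Model n m W)
  iso_parity : ∀ W hW i f, f ∈ M.parity (M.preimage φ W) i ↔ iso W hW f ∈ modelParity n m W i
  iso_res : ∀ (W W' : Opens (Euc n)) (h : W' ≤ W) (hW : (W : Set (Euc n)) ⊆ φ.target)
    (f : M.O (M.preimage φ W)),
    iso W' (fun _ hx => hW (h hx)) (M.res (M.preimage_mono φ h) f) = modelRes m h (iso W hW f)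

end SuperRingedSpace

/-- A supermanifold of dimension `n|m`: a Hausdorff space with countable base and a sheaf of super
`ℝ`-algebras, locally isomorphic to `ℝ^{n|m}`. -/
structure Supermanifold (n m : ℕ) extends SuperRingedSpace.{u} where
  t2 : T2Space carrier
  secondCountable : SecondCountableTopology carrier
  exists_chart : ∀ p : carrier, ∃ c : toSuperRingedSpace.Chart n m, p ∈ c.φ.source

namespace Supermanifold

variable {n m : ℕ} (M : Supermanifold.{u} n m)

theorem super_comm (U : Opens M.carrier) (i j : ZMod 2) (f : M.O U) (hf : f ∈ M.parity U i)
    (g : M.O U) (hg : g ∈ M.parity U j) : f * g = sgn (i * j) • (g * f) := by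
  choose c hc using M.exists_chart
  let W : M.carrier → Opens (Euc n) := fun p => ⟨(c p).φ.target ∩ (c p).φ.symm ⁻¹' U,
    (c p).φ.isOpen_inter_preimage_symm U.isOpen⟩
  have hW : ∀ p, ((W p : Set (Euc n))) ⊆ (c p).φ.target := fun p _ hx => hx.1
  have hle : ∀ p, M.preimage (c p).φ (W p) ≤ U := by
    rintro p x ⟨hx, hx'⟩
    have := hx'.2
    rwa [Set.mem_preimage, (c p).φ.left_inv hx] at this
  refine M.sheaf.eq_of_locally_eq' (fun p : U => M.preimage (c p.1).φ (W p.1)) U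
    (fun p => homOfLE (hle p.1)) ?_ _ _ ?_
  · intro p hp
    rw [Opens.mem_iSup]
    refine ⟨⟨p, hp⟩, hc p, (c p).φ.map_source (hc p), ?_⟩
    rw [Set.mem_preimage, (c p).φ.left_inv (hc p)]
    exact hp
  · rintro ⟨p, _⟩
    change M.res (hle p) (f * g) = M.res (hle p) (sgn (i * j) • (g * f))
    rw [map_mul, map_smul, map_mul]
    apply ((c p).iso (W p) (hW p)).injective
    rw [map_mul, map_smul, map_mul]
    exact model_comm n m (W p) i j _ _
      (((c p).iso_parity _ _ _ _).1 (M.res_mem _ hf))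
      (((c p).iso_parity _ _ _ _).1 (M.res_mem _ hg))

/-! ### Vector fields -/

/-- The sections over `U` of the tangent sheaf: derivations of the structure sheaf restricted to
`U`, i.e. families of derivations `X_V` of the super algebras `𝒪_M(V)`, for `V ⊆ U` open, which
commute with the restriction maps. -/
def tangentSheaf (U : Opens M.carrier) :
    Submodule ℝ (∀ V : Below U, Module.End ℝ (M.O V.1)) where
  carrier := {X | (∀ V, X V ∈ der (M.parity V.1)) ∧
    ∀ (V W : Below U) (h : W.1 ≤ V.1) (f : M.O V.1), M.res h (X V f) = X W (M.res h f)}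
  add_mem' := by
    rintro X Y ⟨h1, h2⟩ ⟨h3, h4⟩
    refine ⟨fun V => add_mem (h1 V) (h3 V), fun V W h f => ?_⟩
    simp only [Pi.add_apply, LinearMap.add_apply, map_add, h2 V W h f, h4 V W h f]
  zero_mem' := ⟨fun V => zero_mem _, fun V W h f => by simp⟩
  smul_mem' := by
    rintro c X ⟨h1, h2⟩
    refine ⟨fun V => Submodule.smul_mem _ _ (h1 V), fun V W h f => ?_⟩
    simp only [Pi.smul_apply, LinearMap.smul_apply, map_smul, h2 V W h f]

/-- The vector fields on `U`. -/
abbrev VectorField (U : Opens M.carrier) : Type u := M.tangentSheaf U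

namespace VectorField

variable {M} {U V : Opens M.carrier}

/-- Restriction of vector fields. -/
def res (h : V ≤ U) (X : M.VectorField U) : M.VectorField V :=
  ⟨fun W => X.1 ⟨W.1, le_trans W.2 h⟩, fun W => X.2.1 ⟨W.1, le_trans W.2 h⟩,
    fun W W' h' f => X.2.2 ⟨W.1, le_trans W.2 h⟩ ⟨W'.1, le_trans W'.2 h⟩ h' f⟩

/-- The superfunction `X f`, for a superfunction `f` on the domain of `X`. -/
def apply (X : M.VectorField U) : M.O U →ₗ[ℝ] M.O U := X.1 ⟨U, le_refl U⟩

/-- The vector field `X` is homogeneous of parity `a`. -/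
def HasParity (X : M.VectorField U) (a : ZMod 2) : Prop :=
  ∀ V : Below U, ∀ j, ∀ f ∈ M.parity V.1 j, X.1 V f ∈ M.parity V.1 (a + j)

theorem res_endPart (X : M.VectorField U) (a : ZMod 2) (V W : Below U) (h : W.1 ≤ V.1)
    (f : M.O V.1) : M.res h (endPart (M.parity V.1) a (X.1 V) f) =
      endPart (M.parity W.1) a (X.1 W) (M.res h f) := by
  simp only [endPart, LinearMap.sum_apply, LinearMap.comp_apply, map_sum, M.res_proj,
    X.2.2 V W h]

theorem endPart_mem_der (X : M.VectorField U) (a : ZMod 2) (V : Below U) :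
    endPart (M.parity V.1) a (X.1 V) ∈ der (M.parity V.1) :=
  homDer_le_der _ a (X.2.1 V a)

/-- The homogeneous component of parity `a` of a vector field. -/
def part (a : ZMod 2) (X : M.VectorField U) : M.VectorField U :=
  ⟨fun V => endPart (M.parity V.1) a (X.1 V), X.endPart_mem_der a, X.res_endPart a⟩

/-- The bracket of vector fields: `[X, Y] f = X(Y f) - (-1)^{|X||Y|} Y(X f)` for homogeneous
`X`, `Y`, extended bilinearly. -/
def bracket (X Y : M.VectorField U) : M.VectorField U :=
  ⟨fun V => superBracket (M.parity V.1) (X.1 V) (Y.1 V),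
    fun V => superBracket_mem _ (X.2.1 V) (Y.2.1 V), fun V W h f => by
      simp only [superBracket, LinearMap.sum_apply, LinearMap.sub_apply, LinearMap.smul_apply,
        Module.End.mul_apply, map_sum, map_sub, map_smul, res_endPart _ _ V W h]⟩

/-- The vector field `f X`, for a superfunction `f`. -/
instance : SMul (M.O U) (M.VectorField U) where
  smul f X := ⟨fun V => LinearMap.mulLeft ℝ (M.res V.2 f) * X.1 V,
    fun V => mul_mem_der _ (M.super_comm V.1) _ (X.2.1 V), fun V W h g => by
      simp only [Module.End.mul_apply, LinearMap.mulLeft_apply, map_mul, X.2.2 V W h g]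
      rw [M.res_res]⟩

theorem smul_apply (f : M.O U) (X : M.VectorField U) (V : Below U) (g : M.O V.1) :
    (f • X).1 V g = M.res V.2 f * X.1 V g := rfl

instance : Module (M.O U) (M.VectorField U) where
  one_smul X := Subtype.ext <| funext fun V => LinearMap.ext fun g => by
    rw [smul_apply, map_one, one_mul]
  mul_smul f f' X := Subtype.ext <| funext fun V => LinearMap.ext fun g => by
    rw [smul_apply, smul_apply, smul_apply, map_mul, mul_assoc]
  smul_zero f := Subtype.ext <| funext fun V => LinearMap.ext fun g => by
    rw [smul_apply]
    exact mul_zero _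
  smul_add f X Y := Subtype.ext <| funext fun V => LinearMap.ext fun g => by
    rw [smul_apply]
    exact mul_add _ _ _
  add_smul f f' X := Subtype.ext <| funext fun V => LinearMap.ext fun g => by
    rw [smul_apply, map_add, add_mul]
    rfl
  zero_smul X := Subtype.ext <| funext fun V => LinearMap.ext fun g => by
    rw [smul_apply, map_zero, zero_mul]
    rfl

theorem part_of_hasParity {X : M.VectorField U} {a : ZMod 2} (h : X.HasParity a) :
    X.part a = X := by
  apply Subtype.ext
  funext V
  change endPart (M.parity V.1) a (X.1 V) = X.1 V
  rw [endPart_of_mem (M.parity V.1) (h V), if_pos rfl]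

theorem bracket_apply {X Y : M.VectorField U} {a b : ZMod 2} (hX : X.HasParity a)
    (hY : Y.HasParity b) (f : M.O U) :
    (X.bracket Y).apply f = X.apply (Y.apply f) - sgn (a * b) • Y.apply (X.apply f) := by
  change superBracket (M.parity U) (X.1 ⟨U, le_refl U⟩) (Y.1 ⟨U, le_refl U⟩) f = _
  have h1 := endPart_of_mem (M.parity U) (hX ⟨U, le_refl U⟩)
  have h2 := endPart_of_mem (M.parity U) (hY ⟨U, le_refl U⟩)
  simp only [superBracket, h1, h2, LinearMap.sum_apply, LinearMap.sub_apply]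
  rw [Finset.sum_eq_single a _ (by simp), Finset.sum_eq_single b _ (by simp)]
  · simp [apply]
  · intro b' _ hb
    simp [hb]
  · intro a' _ ha
    simp [ha]

end VectorField

/-! ### Graded Riemannian metrics, connections, Killing fields -/

/-- The sections over `U` of the cotangent sheaf, the dual of the tangent sheaf: `𝒪`-linear
morphisms of sheaves from the tangent sheaf, restricted to `U`, to the structure sheaf. -/
structure OneForm (U : Opens M.carrier) where
  toFun : ∀ V : Below U, M.VectorField V.1 →ₗ[M.O V.1] M.O V.1
  res_toFun : ∀ (V W : Below U) (h : W.1 ≤ V.1) (Y : M.VectorField V.1),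
    M.res h (toFun V Y) = toFun W (Y.res h)

/-- A graded Riemannian metric: a graded-symmetric even non-degenerate `𝒪`-bilinear form on the
tangent sheaf. Linearity over `𝒪` in the first argument reads `⟨fX, Y⟩ = f⟨X, Y⟩`; by graded
symmetry it amounts to `⟨X, fY⟩ = (-1)^{|X||f|} f⟨X, Y⟩` in the second one. Non-degenerate
means that every one-form is `⟨·, X⟩` for a unique vector field `X`. -/
structure GradedMetric where
  inner : ∀ U : Opens M.carrier, M.VectorField U →ₗ[ℝ] M.VectorField U →ₗ[ℝ] M.O U
  res_inner : ∀ (U V : Opens M.carrier) (h : V ≤ U) (X Y : M.VectorField U),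
    M.res h (inner U X Y) = inner V (X.res h) (Y.res h)
  inner_smul_left : ∀ (U : Opens M.carrier) (f : M.O U) (X Y : M.VectorField U),
    inner U (f • X) Y = f * inner U X Y
  inner_even : ∀ (U : Opens M.carrier) (a b : ZMod 2) (X Y : M.VectorField U),
    X.HasParity a → Y.HasParity b → inner U X Y ∈ M.parity U (a + b)
  inner_symm : ∀ (U : Opens M.carrier) (a b : ZMod 2) (X Y : M.VectorField U),
    X.HasParity a → Y.HasParity b → inner U X Y = sgn (a * b) • inner U Y X
  nondegenerate : ∀ (U : Opens M.carrier) (α : M.OneForm U), ∃! X : M.VectorField U,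
    ∀ (V : Below U) (Y : M.VectorField V.1), α.toFun V Y = inner V.1 Y (X.res V.2)

/-- A connection on `M`, given by its covariant derivative `(X, Y) ↦ ∇_X Y`. -/
structure Connection where
  cov : ∀ U : Opens M.carrier, M.VectorField U →ₗ[ℝ] M.VectorField U →ₗ[ℝ] M.VectorField U
  res_cov : ∀ (U V : Opens M.carrier) (h : V ≤ U) (X Y : M.VectorField U),
    (cov U X Y).res h = cov V (X.res h) (Y.res h)
  cov_even : ∀ (U : Opens M.carrier) (a b : ZMod 2) (X Y : M.VectorField U),
    X.HasParity a → Y.HasParity b → (cov U X Y).HasParity (a + b)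
  cov_smul_left : ∀ (U : Opens M.carrier) (f : M.O U) (X Y : M.VectorField U),
    cov U (f • X) Y = f • cov U X Y
  leibniz : ∀ (U : Opens M.carrier) (a b : ZMod 2) (f : M.O U) (X Y : M.VectorField U),
    X.HasParity a → f ∈ M.parity U b →
    cov U X (f • Y) = X.apply f • Y + sgn (a * b) • (f • cov U X Y)

variable {M}

namespace Connection

variable (D : M.Connection)

/-- The torsion of the connection vanishes: `∇_X Y - (-1)^{|X||Y|} ∇_Y X - [X, Y] = 0`. -/
def IsTorsionFree : Prop :=
  ∀ (U : Opens M.carrier) (a b : ZMod 2) (X Y : M.VectorField U),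
    X.HasParity a → Y.HasParity b →
    D.cov U X Y - sgn (a * b) • D.cov U Y X - X.bracket Y = 0

/-- The connection is metric: `X⟨Y, Z⟩ = ⟨∇_X Y, Z⟩ + (-1)^{|X||Y|} ⟨Y, ∇_X Z⟩`. -/
def IsMetric (g : M.GradedMetric) : Prop :=
  ∀ (U : Opens M.carrier) (a b : ZMod 2) (X Y Z : M.VectorField U),
    X.HasParity a → Y.HasParity b →
    X.apply (g.inner U Y Z) =
      g.inner U (D.cov U X Y) Z + sgn (a * b) • g.inner U Y (D.cov U X Z)

/-- `D` is the Levi-Civita connection of `g`, the unique torsionless and metric connection. -/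
def IsLeviCivita (g : M.GradedMetric) : Prop :=
  D.IsTorsionFree ∧ D.IsMetric g

/-- The curvature `R(X, Y) Z = [∇_X, ∇_Y] Z - ∇_{[X, Y]} Z`. Here
`[∇_X, ∇_Y] = ∇_X ∇_Y - (-1)^{|X||Y|} ∇_Y ∇_X` for homogeneous `X`, `Y`, extended bilinearly. -/
def curvature {U : Opens M.carrier} (X Y Z : M.VectorField U) : M.VectorField U :=
  ∑ a : ZMod 2, ∑ b : ZMod 2, (D.cov U (X.part a) (D.cov U (Y.part b) Z) -
    sgn (a * b) • D.cov U (Y.part b) (D.cov U (X.part a) Z)) - D.cov U (X.bracket Y) Z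

/-- The second covariant derivative `∇²_{Y,Z} X = ∇_Y ∇_Z X - ∇_{∇_Y Z} X`. -/
def secondCov {U : Opens M.carrier} (Y Z X : M.VectorField U) : M.VectorField U :=
  D.cov U Y (D.cov U Z X) - D.cov U (D.cov U Y Z) X

end Connection

/-- A graded Killing vector field: a vector field `X` on `M` such that
`X⟨Y, Z⟩ = ⟨[X, Y], Z⟩ + (-1)^{|X||Y|} ⟨Y, [X, Z]⟩` for all `Y`, `Z`. For a field which is not
homogeneous, this is required of its homogeneous components. -/
def GradedMetric.IsKilling (g : M.GradedMetric) (X : M.VectorField ⊤) : Prop :=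
  ∀ (U : Opens M.carrier) (a b : ZMod 2) (Y Z : M.VectorField U), Y.HasParity b →
    ((X.part a).res (le_top : U ≤ ⊤)).apply (g.inner U Y Z) =
      g.inner U (((X.part a).res (le_top : U ≤ ⊤)).bracket Y) Z +
        sgn (a * b) • g.inner U Y (((X.part a).res (le_top : U ≤ ⊤)).bracket Z)

end Supermanifold

end Super

end

/-!
The statement is that a Killing field `X` preserves the Levi-Civita connection, rewritten.  The Lie
derivative of the connection along `X` is the tensor
`S(Y, Z) = [X, ∇_Y Z] - ∇_{[X, Y]} Z - (-1)^{|X||Y|} ∇_Y [X, Z]`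
(`Connection.lieDeriv`).  By the Jacobi identity and the vanishing of the torsion, `S` is graded
symmetric (`Connection.lieDeriv_symm`).  Applying the Killing equation and the metric property to
`[X, Y]⟨Z, W⟩ = X(Y⟨Z, W⟩) - (-1)^{|X||Y|} Y(X⟨Z, W⟩)` shows that `⟨S(Y, Z), W⟩` is graded skew in
`Z` and `W` (`Connection.inner_lieDeriv_add`).  A trilinear form which is symmetric in the first two
and skew in the last two arguments is zero, as it is minus itself after going around the
permutations of its arguments; so `S = 0` because the metric is non-degenerate.

Finally, replacing each bracket `[X, V]` with `V = ∇_Y Z` or `V = Z` in `S` by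
`∇_X V - (-1)^{|X||V|} ∇_V X` turns `S(Y, Z)` into
`R(X, Y) Z + (-1)^{|X|(|Y| + |Z|)} ∇²_{Y, Z} X` (`Connection.lieDeriv_eq_curvature_add`).
No symmetry of the curvature tensor is needed.
-/

namespace Super

theorem sgn_eq_one_or (i : ZMod 2) : sgn i = 1 ∨ sgn i = -1 := by
  rcases parity_cases i with rfl | rfl
  · exact Or.inl sgn_zero
  · exact Or.inr sgn_one

namespace Supermanifold

variable {n m : ℕ} {M : Supermanifold.{u} n m}

/-! ### Homogeneous vector fields and the Jacobi identity -/

namespace VectorField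

variable {U V : Opens M.carrier}

theorem HasParity.res {X : M.VectorField U} {a : ZMod 2} (hX : X.HasParity a) (h : V ≤ U) :
    (X.res h).HasParity a :=
  fun W => hX ⟨W.1, le_trans W.2 h⟩

theorem hasParity_part (a : ZMod 2) (X : M.VectorField U) : (X.part a).HasParity a :=
  fun V => (X.2.1 V a).1

theorem sum_part (X : M.VectorField U) : ∑ a, X.part a = X := by
  apply Subtype.ext
  funext V
  rw [Submodule.coe_sum, Finset.sum_apply]
  exact sum_endPart (M.parity V.1) (X.1 V)

theorem part_of_hasParity_of_ne {X : M.VectorField U} {a b : ZMod 2} (hX : X.HasParity a)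
    (h : b ≠ a) : X.part b = 0 := by
  apply Subtype.ext
  funext V
  change endPart (M.parity V.1) b (X.1 V) = 0
  rw [endPart_of_mem (M.parity V.1) (hX V), if_neg h]

theorem bracket_val {X Y : M.VectorField U} {a b : ZMod 2} (hX : X.HasParity a)
    (hY : Y.HasParity b) (V : Below U) :
    (X.bracket Y).1 V = X.1 V * Y.1 V - sgn (a * b) • (Y.1 V * X.1 V) :=
  LinearMap.ext fun f => bracket_apply (hX.res V.2) (hY.res V.2) f

theorem HasParity.bracket {X Y : M.VectorField U} {a b : ZMod 2} (hX : X.HasParity a)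
    (hY : Y.HasParity b) : (X.bracket Y).HasParity (a + b) := by
  intro V j f hf
  rw [bracket_val hX hY]
  refine sub_mem ?_ (Submodule.smul_mem _ _ ?_)
  · rw [add_assoc]
    exact hX V _ _ (hY V j f hf)
  · rw [add_comm a, add_assoc]
    exact hY V _ _ (hX V j f hf)

theorem HasParity.sub {X Y : M.VectorField U} {a : ZMod 2} (hX : X.HasParity a)
    (hY : Y.HasParity a) : (X - Y).HasParity a :=
  fun V j f hf => sub_mem (hX V j f hf) (hY V j f hf)

theorem HasParity.smul {X : M.VectorField U} {a : ZMod 2} (hX : X.HasParity a) (r : ℝ) :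
    (r • X).HasParity a :=
  fun V j f hf => Submodule.smul_mem _ _ (hX V j f hf)

theorem bracket_sub_smul {X Y Y' : M.VectorField U} {a b : ZMod 2} (hX : X.HasParity a)
    (hY : Y.HasParity b) (hY' : Y'.HasParity b) (r : ℝ) :
    X.bracket (Y - r • Y') = X.bracket Y - r • X.bracket Y' := by
  apply Subtype.ext
  funext V
  change (X.bracket (Y - r • Y')).1 V = (X.bracket Y).1 V - r • (X.bracket Y').1 V
  rw [bracket_val hX (hY.sub (hY'.smul r)), bracket_val hX hY, bracket_val hX hY']
  change X.1 V * (Y.1 V - r • Y'.1 V) - sgn (a * b) • ((Y.1 V - r • Y'.1 V) * X.1 V) = _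
  simp only [mul_sub, sub_mul, mul_smul_comm, smul_mul_assoc]
  module

/-- The Jacobi identity: `[X, ·]` is a derivation of the bracket. -/
theorem bracket_bracket {X Y Z : M.VectorField U} {a b c : ZMod 2} (hX : X.HasParity a)
    (hY : Y.HasParity b) (hZ : Z.HasParity c) :
    X.bracket (Y.bracket Z) =
      (X.bracket Y).bracket Z + sgn (a * b) • Y.bracket (X.bracket Z) := by
  apply Subtype.ext
  funext V
  change (X.bracket (Y.bracket Z)).1 V =
    ((X.bracket Y).bracket Z).1 V + sgn (a * b) • (Y.bracket (X.bracket Z)).1 V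
  rw [bracket_val hX (hY.bracket hZ), bracket_val (hX.bracket hY) hZ,
    bracket_val hY (hX.bracket hZ), bracket_val hX hY, bracket_val hY hZ, bracket_val hX hZ]
  simp only [mul_add, add_mul, sgn_add, mul_comm b a, mul_sub, sub_mul, mul_smul_comm,
    smul_mul_assoc, mul_assoc]
  rcases sgn_eq_one_or (a * b) with h | h <;> rw [h] <;> module

end VectorField

open Super.Supermanifold.VectorField

/-! ### Non-degeneracy of the metric -/

theorem GradedMetric.inner_sub_sub_smul (g : M.GradedMetric) {U : Opens M.carrier}
    (P Q R W : M.VectorField U) (r : ℝ) :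
    g.inner U (P - Q - r • R) W = g.inner U P W - g.inner U Q W - r • g.inner U R W := by
  have h := LinearMap.map_sub₂ (g.inner U) (P - Q) (r • R) W
  have h' := LinearMap.map_sub₂ (g.inner U) P Q W
  rw [LinearMap.map_smul₂] at h
  exact h.trans (congrArg (· - r • g.inner U R W) h')

theorem GradedMetric.inner_sub_sub_smul_right (g : M.GradedMetric) {U : Opens M.carrier}
    (W P Q R : M.VectorField U) (r : ℝ) :
    g.inner U W (P - Q - r • R) = g.inner U W P - g.inner U W Q - r • g.inner U W R := by
  have h := LinearMap.map_sub (g.inner U W) (P - Q) (r • R)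
  have h' := LinearMap.map_sub (g.inner U W) P Q
  rw [LinearMap.map_smul] at h
  exact h.trans (congrArg (· - r • g.inner U W R) h')

/-- A homogeneous vector field which is orthogonal to all homogeneous vector fields on smaller
open sets is zero. -/
theorem GradedMetric.eq_zero_of_inner_eq_zero (g : M.GradedMetric) {U : Opens M.carrier}
    {S : M.VectorField U} {s : ZMod 2} (hS : S.HasParity s)
    (h : ∀ (V : Below U) (d : ZMod 2) (W : M.VectorField V.1), W.HasParity d →
      g.inner V.1 (S.res V.2) W = 0) : S = 0 := by
  obtain ⟨_, -, huniq⟩ := g.nondegenerate U ⟨fun _ => 0, fun _ _ _ _ => map_zero _⟩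
  refine (huniq S fun V W => ?_).trans (huniq 0 fun V W => ?_).symm
  · change 0 = g.inner V.1 W (S.res V.2)
    rw [← W.sum_part, map_sum, LinearMap.sum_apply]
    refine (Finset.sum_eq_zero fun d _ => ?_).symm
    rw [g.inner_symm V.1 d s _ _ (W.hasParity_part d) (hS.res V.2),
      h V d _ (W.hasParity_part d), smul_zero]
  · exact (map_zero (g.inner V.1 W)).symm

/-! ### The Lie derivative of a connection -/

namespace Connection

variable (D : M.Connection) {U V : Opens M.carrier}

/-
Vector fields on `U` are elements of a submodule, and their subtraction unifies only with
difficulty with the one of an additive group. Therefore the ambient modules of `map_sub` are given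
explicitly, and longer rearrangements of terms are proved in an abstract module `E`.
-/

/-- The Lie derivative along `X` of the connection `D`,
`(Y, Z) ↦ [X, ∇_Y Z] - ∇_{[X, Y]} Z - (-1)^{ab} ∇_Y [X, Z]`, for `X` and `Y` of parities `a`
and `b`. The parities are arguments, as they are not determined by `X` and `Y`
if these are zero. -/
def lieDeriv (a b : ZMod 2) (X Y Z : M.VectorField U) : M.VectorField U :=
  X.bracket (D.cov U Y Z) - D.cov U (X.bracket Y) Z - sgn (a * b) • D.cov U Y (X.bracket Z)

theorem cov_sub_smul (X Y Z : M.VectorField U) (r : ℝ) :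
    D.cov U X (Y - r • Z) = D.cov U X Y - r • D.cov U X Z := by
  have h := LinearMap.map_sub (M := M.VectorField U) (M₂ := M.VectorField U) (D.cov U X) Y (r • Z)
  rwa [LinearMap.map_smul] at h

theorem res_lieDeriv (h : V ≤ U) (a b : ZMod 2) (X Y Z : M.VectorField U) :
    (D.lieDeriv a b X Y Z).res h = D.lieDeriv a b (X.res h) (Y.res h) (Z.res h) := by
  change (X.res h).bracket ((D.cov U Y Z).res h) - (D.cov U (X.bracket Y) Z).res h -
    sgn (a * b) • (D.cov U Y (X.bracket Z)).res h = _
  rw [D.res_cov, D.res_cov, D.res_cov]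
  rfl

variable {D} {X Y Z : M.VectorField U} {a b c : ZMod 2}

theorem hasParity_lieDeriv (hX : X.HasParity a) (hY : Y.HasParity b) (hZ : Z.HasParity c) :
    (D.lieDeriv a b X Y Z).HasParity (a + b + c) := by
  refine ((?_ : HasParity _ _).sub (D.cov_even U _ _ _ _ (hX.bracket hY) hZ)).sub
    (HasParity.smul ?_ _)
  · rw [add_assoc]
    exact hX.bracket (D.cov_even U _ _ _ _ hY hZ)
  · rw [add_comm a b, add_assoc]
    exact D.cov_even U _ _ _ _ hY (hX.bracket hZ)

theorem IsTorsionFree.bracket_eq (hD : D.IsTorsionFree) (hX : X.HasParity a)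
    (hY : Y.HasParity b) :
    X.bracket Y = D.cov U X Y - sgn (a * b) • D.cov U Y X :=
  (sub_eq_zero.1 (hD U a b X Y hX hY)).symm

theorem lieDeriv_symm (hD : D.IsTorsionFree) (hX : X.HasParity a) (hY : Y.HasParity b)
    (hZ : Z.HasParity c) :
    D.lieDeriv a b X Y Z = sgn (b * c) • D.lieDeriv a c X Z Y := by
  -- The rearrangement of terms, for the signs `x = (-1)^{ab}`, `y = (-1)^{bc}`, `z = (-1)^{ac}`.
  have rearrange : ∀ {E : Type u} [AddCommGroup E] [Module ℝ E] {P Q A A' B B' : E} {x y z : ℝ},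
      x = 1 ∨ x = -1 → P - y • Q = A - (z * y) • A' + x • (B - (x * y) • B') →
      P - A - x • B = y • (Q - B' - z • A') := by
    rintro E _ _ P Q A A' B B' x y z (rfl | rfl) h <;> linear_combination (norm := module) h
  have hZY := D.cov_even U _ _ _ _ hZ hY
  rw [add_comm c b] at hZY
  have h := bracket_sub_smul hX (D.cov_even U _ _ _ _ hY hZ) hZY (sgn (b * c))
  rw [← hD.bracket_eq hY hZ, bracket_bracket hX hY hZ, hD.bracket_eq (hX.bracket hY) hZ,
    hD.bracket_eq hY (hX.bracket hZ), add_mul, mul_add, sgn_add, sgn_add, mul_comm b a] at h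
  exact rearrange (E := M.VectorField U) (sgn_eq_one_or _) h.symm

set_option maxHeartbeats 1000000 in
/-- The connection and the Killing field both preserve the metric, hence so does the Lie
derivative of the connection. -/
theorem inner_lieDeriv_add {g : M.GradedMetric} (hD : D.IsMetric g) (hX : X.HasParity a)
    (hK : ∀ (b : ZMod 2) (Y Z : M.VectorField U), Y.HasParity b →
      X.apply (g.inner U Y Z) =
        g.inner U (X.bracket Y) Z + sgn (a * b) • g.inner U Y (X.bracket Z))
    (hY : Y.HasParity b) (hZ : Z.HasParity c) (W : M.VectorField U) :
    g.inner U (D.lieDeriv a b X Y Z) W +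
      sgn ((a + b) * c) • g.inner U Z (D.lieDeriv a b X Y W) = 0 := by
  -- The rearrangement of terms, for the signs `x = (-1)^{ab}`, `y = (-1)^{bc}`, `z = (-1)^{ac}`.
  have rearrange : ∀ {E : Type u} [AddCommGroup E] [Module ℝ E]
      {A A' P P' Q Q' R S : E} {x y z : ℝ}, x = 1 ∨ x = -1 →
      A + (z * y) • A' = P + (x * z) • R + y • (S + z • P') -
        x • (Q + (x * y) • S + z • (R + y • Q')) →
      P - A - x • Q + (z * y) • (P' - A' - x • Q') = 0 := by
    rintro E _ _ A A' P P' Q Q' R S x y z (rfl | rfl) h <;> linear_combination (norm := module) -h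
  have hYZ := D.cov_even U _ _ _ _ hY hZ
  have h := bracket_apply hX hY (g.inner U Z W)
  have h1 := hD U _ _ _ _ W (hX.bracket hY) hZ
  have h2 := hD U _ _ _ _ W hY hZ
  have h3 := hK _ Z W hZ
  have h4 := hK _ _ W hYZ
  have h5 := hK _ Z (D.cov U Y W) hZ
  have h6 := hD U _ _ _ _ W hY (hX.bracket hZ)
  have h7 := hD U _ _ _ _ (X.bracket W) hY hZ
  have hX' : ∀ (r : ℝ) (p q : M.O U), X.apply (p + r • q) = X.apply p + r • X.apply q := by
    intro r p q
    rw [LinearMap.map_add, LinearMap.map_smul]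
  have hY' : ∀ (r : ℝ) (p q : M.O U), Y.apply (p + r • q) = Y.apply p + r • Y.apply q := by
    intro r p q
    rw [LinearMap.map_add, LinearMap.map_smul]
  have hs1 : sgn ((a + b) * c) = sgn (a * c) * sgn (b * c) := by rw [add_mul, sgn_add]
  have hs2 : sgn (a * (b + c)) = sgn (a * b) * sgn (a * c) := by rw [mul_add, sgn_add]
  have hs3 : sgn (b * (a + c)) = sgn (a * b) * sgn (b * c) := by
    rw [mul_add, sgn_add, mul_comm b a]
  rw [h1, h2, h3, hX', hY', h4, h5, h6, h7, hs1, hs2, hs3] at h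
  rw [lieDeriv, lieDeriv, g.inner_sub_sub_smul, g.inner_sub_sub_smul_right, hs1]
  exact rearrange (sgn_eq_one_or _) h

theorem inner_lieDeriv_eq_zero {g : M.GradedMetric} (hD : D.IsLeviCivita g) (hX : X.HasParity a)
    (hK : ∀ (b : ZMod 2) (Y Z : M.VectorField U), Y.HasParity b →
      X.apply (g.inner U Y Z) =
        g.inner U (X.bracket Y) Z + sgn (a * b) • g.inner U Y (X.bracket Z))
    (hY : Y.HasParity b) (hZ : Z.HasParity c) {W : M.VectorField U} {d : ZMod 2}
    (hW : W.HasParity d) : g.inner U (D.lieDeriv a b X Y Z) W = 0 := by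
  have symm : ∀ {b c : ZMod 2} {Y Z : M.VectorField U} (W : M.VectorField U), Y.HasParity b →
      Z.HasParity c → g.inner U (D.lieDeriv a b X Y Z) W =
        sgn (b * c) • g.inner U (D.lieDeriv a c X Z Y) W := by
    intro b c Y Z W hY hZ
    rw [lieDeriv_symm hD.1 hX hY hZ, map_smul, LinearMap.smul_apply]
  have skew : ∀ {b c d : ZMod 2} {Y Z W : M.VectorField U}, Y.HasParity b → Z.HasParity c →
      W.HasParity d → g.inner U (D.lieDeriv a b X Y Z) W =
        -(sgn (c * d) • g.inner U (D.lieDeriv a b X Y W) Z) := by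
    intro b c d Y Z W hY hZ hW
    have h := inner_lieDeriv_add hD.2 hX hK hY hZ W
    rw [g.inner_symm U _ _ _ _ hZ (hasParity_lieDeriv hX hY hW), smul_smul, mul_add c, sgn_add,
      mul_comm c (a + b), ← mul_assoc, sgn_mul_self, one_mul] at h
    exact eq_neg_of_add_eq_zero_left h
  -- Three transpositions of the first two arguments, alternating with two transpositions of the
  -- last two, lead from `(Y, Z, W)` to `(Y, W, Z)` with a plus sign. A single transposition of the
  -- last two arguments does so with a minus sign.
  have h1 : g.inner U (D.lieDeriv a b X Y Z) W =
      sgn (c * d) • g.inner U (D.lieDeriv a b X Y W) Z := by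
    rw [symm W hY hZ, skew hZ hY hW, symm Y hZ hW, skew hW hZ hY, symm Z hW hY]
    simp only [smul_neg, neg_neg, smul_smul]
    congr 1
    rw [mul_comm c b, mul_comm d b]
    linear_combination sgn (c * d) * (sgn (b * d) * sgn (b * d) * sgn_mul_self (b * c) +
      sgn_mul_self (b * d))
  have h2 := skew hY hZ hW
  linear_combination (norm := module) (1 / 2 : ℝ) • h1 + (1 / 2 : ℝ) • h2

/-- A Killing field preserves the Levi-Civita connection. -/
theorem lieDeriv_eq_zero {g : M.GradedMetric} (hD : D.IsLeviCivita g) (hX : X.HasParity a)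
    (hK : ∀ (V : Below U) (b : ZMod 2) (Y Z : M.VectorField V.1), Y.HasParity b →
      (X.res V.2).apply (g.inner V.1 Y Z) = g.inner V.1 ((X.res V.2).bracket Y) Z +
        sgn (a * b) • g.inner V.1 Y ((X.res V.2).bracket Z))
    (hY : Y.HasParity b) (hZ : Z.HasParity c) : D.lieDeriv a b X Y Z = 0 := by
  refine g.eq_zero_of_inner_eq_zero (hasParity_lieDeriv hX hY hZ) fun V d W hW => ?_
  rw [res_lieDeriv]
  exact inner_lieDeriv_eq_zero hD (hX.res V.2) (hK V) (hY.res V.2) (hZ.res V.2) hW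

/-! ### The curvature -/

theorem curvature_eq (hX : X.HasParity a) (hY : Y.HasParity b) (Z : M.VectorField U) :
    D.curvature X Y Z = D.cov U X (D.cov U Y Z) - sgn (a * b) • D.cov U Y (D.cov U X Z) -
      D.cov U (X.bracket Y) Z := by
  have h0 : ∀ W : M.VectorField U, D.cov U 0 W = 0 := fun W => LinearMap.map_zero₂ _ W
  have h0' : ∀ W : M.VectorField U, D.cov U W 0 = 0 := fun W => LinearMap.map_zero _
  have hz : ∀ x : ℝ, (0 : M.VectorField U) - x • (0 : M.VectorField U) = 0 := fun x => by
    rw [smul_zero]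
    exact sub_self (G := M.VectorField U) 0
  rw [curvature, Finset.sum_eq_single a, Finset.sum_eq_single b, part_of_hasParity hX,
    part_of_hasParity hY]
  · intro b' _ hb
    rw [part_of_hasParity_of_ne hY hb, h0, h0, h0']
    exact hz _
  · exact fun h => absurd (Finset.mem_univ _) h
  · intro a' _ ha
    refine Finset.sum_eq_zero fun b' _ => ?_
    rw [part_of_hasParity_of_ne hX ha, h0, h0, h0']
    exact hz _
  · exact fun h => absurd (Finset.mem_univ _) h

set_option maxHeartbeats 1000000 in
/-- Replacing `[X, ∇_Y Z]` and `[X, Z]` by covariant derivatives, but keeping `[X, Y]`, turns the Lie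
derivative of a torsion-free connection into a curvature and a second derivative of `X`. -/
theorem lieDeriv_eq_curvature_add (hD : D.IsTorsionFree) (hX : X.HasParity a)
    (hY : Y.HasParity b) (hZ : Z.HasParity c) :
    D.lieDeriv a b X Y Z =
      D.curvature X Y Z + sgn (a * (b + c)) • D.secondCov Y Z X := by
  have rearrange : ∀ {E : Type u} [AddCommGroup E] [Module ℝ E] {P Q R S T : E} {x z : ℝ},
      P - (x * z) • Q - R - x • (S - z • T) = P - x • S - R + (x * z) • (T - Q) := by
    intros
    module
  have hs : sgn (a * (b + c)) = sgn (a * b) * sgn (a * c) := by rw [mul_add, sgn_add]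
  rw [lieDeriv, curvature_eq hX hY, secondCov, hD.bracket_eq hX (D.cov_even U _ _ _ _ hY hZ),
    hD.bracket_eq hX hZ, cov_sub_smul, hs]
  exact rearrange (E := M.VectorField U)

end Connection

end Supermanifold

end Super

theorem mainTheorem12 {n m : ℕ} (M : Super.Supermanifold.{u} n m) (g : M.GradedMetric)
    (D : M.Connection) (hD : D.IsLeviCivita g) (X : M.VectorField ⊤) (hX : g.IsKilling X)
    (a b c : ZMod 2) (U : TopologicalSpace.Opens M.carrier) (Y Z : M.VectorField U)
    (hY : Y.HasParity b) (hZ : Z.HasParity c) :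
    D.secondCov Y Z ((X.part a).res (le_top : U ≤ ⊤)) =
      -(Super.sgn (a * (b + c)) • D.curvature ((X.part a).res (le_top : U ≤ ⊤)) Y Z) := by
  have hK := (X.hasParity_part a).res (le_top : U ≤ ⊤)
  have h := Super.Supermanifold.Connection.lieDeriv_eq_curvature_add hD.1 hK hY hZ
  rw [Super.Supermanifold.Connection.lieDeriv_eq_zero hD hK
    (fun V b' Y' Z' hY' => hX V.1 a b' Y' Z' hY') hY hZ] at h
  have cancel : ∀ {E : Type u} [AddCommGroup E] [Module ℝ E] {R S : E} {x : ℝ},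
      x = 1 ∨ x = -1 → 0 = R + x • S → S = -(x • R) := by
    rintro E _ _ R S x (rfl | rfl) h
    · linear_combination (norm := module) -h
    · linear_combination (norm := module) h
  exact cancel (E := M.VectorField U) (Super.sgn_eq_one_or _) h
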